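/- A finite binary dictionary is a finite list of translations $x_1 \to y_1, \ldots, x_n \to y_n$, where the $x_i$ (the words) and the $y_i$ are binary strings. It is prefix-free if $x_i$ is not a prefix of $x_j$ whenever $i \neq j$. Given such a dictionary $D$ and a binary string $A$, the dictionary process of $D$ started from $A$ is the following. A reader starts at the left endpoint of the current string, which is initially $A$, and reads to the right until the bits it has read form a word $x_i$ of $D$; then $y_i$ is appended at the right end of the current string, and the reader continues from where it stopped, reading until it finds the next word, and so on. The process terminates if the reader at some stage reaches the right endpoint of the current string without finding a word. The following two problems are algorithmically undecidable (no computable predicate answers them correctly on all the stated inputs): 1. Given a prefix-free finite binary dictionary $D$ and a binary string $A$, does the dictionary process of $D$ started from $A$ terminate? 2. Given a prefix-free finite binary dictionary $D$, a binary string $A$ and a binary string $w$, is $w$ a word of $D$ that is ever found by the reader in the dictionary process of $D$ started from $A$? -/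

import Mathlib

/-- A finite binary dictionary: a finite list of translations `x → y` of binary strings,
the pair `(x, y)` consisting of a word `x` and its translation `y`. -/
abbrev BinaryDictionary : Type := List (List Bool × List Bool)

namespace BinaryDictionary

/-- No word of the dictionary is a prefix of the word of another entry. -/
def PrefixFree (D : BinaryDictionary) : Prop :=
  D.Pairwise fun e e' => ¬ e.1 <+: e'.1 ∧ ¬ e'.1 <+: e.1

/-- A stage of the dictionary process. The current string is `read ++ unread`; the reader stands
between the two parts and the writer at the right end of `unread`. -/
structure Config where
  read : List Bool
  unread : List Bool

/-- The process starts with the reader at the left endpoint of the starting string. -/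
def start (A : List Bool) : Config := ⟨[], A⟩

/-- One step: the reader, going on from where it stands, finds the dictionary word `x`, and
the writer appends the translation `y` of `x` to the right of the current string. -/
def Step (D : BinaryDictionary) (c c' : Config) : Prop :=
  ∃ x y v : List Bool, (x, y) ∈ D ∧ c.unread = x ++ v ∧
    c'.read = c.read ++ x ∧ c'.unread = v ++ y

/-- The process with dictionary `D` and starting string `A` reaches the stage `c`. -/
def Reaches (D : BinaryDictionary) (A : List Bool) (c : Config) : Prop :=
  Relation.ReflTransGen (Step D) (start A) c

/-- The process terminates: it reaches a stage from which the reader gets to the right endpoint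
of the current string without finding a word of the dictionary. -/
def Terminates (D : BinaryDictionary) (A : List Bool) : Prop :=
  ∃ c, Reaches D A c ∧ ¬ ∃ c', Step D c c'

/-- At some stage of the process the reader finds the dictionary word `w`. -/
def EverReads (D : BinaryDictionary) (A w : List Bool) : Prop :=
  (∃ y, (w, y) ∈ D) ∧ ∃ c, Reaches D A c ∧ w <+: c.unread

end BinaryDictionary

namespace BinaryDictionary

open Relation StateTransition

/-! ### Determinism of the dictionary process -/

/-! The unread part of the string is a queue, and a queue can simulate a machine. Halting of
`ToPartrec.Code` programs passes to Mathlib's stack machine `PartrecToTM2.tr`, then to a deque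
machine, then to a dictionary. A deque configuration becomes its state letter followed by its
symbols, each letter coded as `1ⁿ0`. A symbol met alone is copied to the back; a state followed by a
symbol performs a step (`DequeStep.transGen_step`). The stacks are interleaved on one deque and
found by rotating it (`transGen_tm2Deque`). The halting letter starts no word, so the process stops
exactly when the machine halts (`respects_tm2Dictionary`). For the second problem the halting letter
is added as a word: it is read if and only if the original process stops (`everReads_cons_iff`). One
fixed dictionary serves each problem; only the starting string varies. -/

theorem PrefixFree.eq_of_prefix {D : BinaryDictionary} (hD : D.PrefixFree)
    {e e' : List Bool × List Bool} (he : e ∈ D) (he' : e' ∈ D) (h : e.1 <+: e'.1) : e = e' := by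
  by_contra hne
  have : Std.Symm fun e e' : List Bool × List Bool => ¬ e.1 <+: e'.1 ∧ ¬ e'.1 <+: e.1 :=
    ⟨fun _ _ => And.symm⟩
  exact (List.Pairwise.forall hD he he' hne).1 h

theorem Step.unique {D : BinaryDictionary} (hD : D.PrefixFree) {c c₁ c₂ : Config}
    (h₁ : Step D c c₁) (h₂ : Step D c c₂) : c₁ = c₂ := by
  obtain ⟨x, y, v, hxy, hu, hr, hv⟩ := h₁
  obtain ⟨x', y', v', hxy', hu', hr', hv'⟩ := h₂
  have hx : (x, y) = (x', y') := by
    rcases List.prefix_or_prefix_of_prefix (⟨v, hu.symm⟩ : x <+: c.unread) ⟨v', hu'.symm⟩ with h | h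
    · exact hD.eq_of_prefix hxy hxy' h
    · exact (hD.eq_of_prefix hxy' hxy h).symm
  cases hx
  rw [hu, List.append_cancel_left_eq] at hu'
  subst hu'
  cases c₁; cases c₂; simp_all

open scoped Classical in
/-- The dictionary process as a partial function on stages. -/
noncomputable def next (D : BinaryDictionary) (c : Config) : Option Config :=
  if h : ∃ c', Step D c c' then some h.choose else none

theorem mem_next {D : BinaryDictionary} (hD : D.PrefixFree) {c c' : Config} :
    c' ∈ next D c ↔ Step D c c' := by
  unfold next
  split_ifs with h
  · simp only [Option.mem_def, Option.some.injEq]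
    exact ⟨fun e => e ▸ h.choose_spec, fun h' => h.choose_spec.unique hD h'⟩
  · simpa using fun h' => h ⟨c', h'⟩

theorem next_eq_none {D : BinaryDictionary} {c : Config} :
    next D c = none ↔ ¬ ∃ c', Step D c c' := by
  unfold next
  split_ifs with h <;> simp [h]

theorem next_rel {D : BinaryDictionary} (hD : D.PrefixFree) :
    (fun a b => b ∈ next D a) = Step D := by
  funext a b
  exact propext (mem_next hD)

theorem mem_eval_next {D : BinaryDictionary} (hD : D.PrefixFree) {c c' : Config} :
    c' ∈ eval (next D) c ↔ ReflTransGen (Step D) c c' ∧ ¬ ∃ c'', Step D c' c'' := by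
  rw [mem_eval, StateTransition.Reaches, next_rel hD, next_eq_none]

theorem terminates_iff {D : BinaryDictionary} (hD : D.PrefixFree) {A : List Bool} :
    D.Terminates A ↔ (eval (next D) (start A)).Dom := by
  simp only [Terminates, BinaryDictionary.Reaches, Part.dom_iff_mem, mem_eval_next hD]

/-- A word outside the dictionary at which the process always stops is read, once it is added to
the dictionary, exactly when the process terminates. -/
theorem everReads_cons_iff {D : BinaryDictionary} {w y A : List Bool}
    (hD : PrefixFree ((w, y) :: D))
    (H : ∀ c ∈ eval (next D) (start A), w <+: c.unread) :
    EverReads ((w, y) :: D) A w ↔ D.Terminates A := by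
  have hD' : D.PrefixFree := (List.pairwise_cons.1 hD).2
  have mono : ∀ {c c'}, Step D c c' → Step ((w, y) :: D) c c' := by
    rintro c c' ⟨x, z, v, hx, h⟩
    exact ⟨x, z, v, List.mem_cons_of_mem _ hx, h⟩
  constructor
  · rintro ⟨-, c, hc, hw⟩
    by_contra hT
    have hstep : ∀ {c}, BinaryDictionary.Reaches D A c → ∃ c', Step D c c' := by
      intro c hc
      by_contra h
      exact hT ⟨c, hc, h⟩
    -- Since `D` never stops, determinism forces every step of the larger dictionary to be the step
    -- of `D`.
    have key : ∀ c, ReflTransGen (Step ((w, y) :: D)) (start A) c →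
        ReflTransGen (Step D) (start A) c := by
      intro c hc
      induction hc with
      | refl => exact .refl
      | tail _ h ih =>
        obtain ⟨c', hc'⟩ := hstep ih
        exact ih.tail ((mono hc').unique hD h ▸ hc')
    obtain ⟨c', x, z, v, hx, hu, -⟩ := hstep (key c hc)
    rcases List.prefix_or_prefix_of_prefix hw ⟨v, hu.symm⟩ with h | h
    · exact ((List.pairwise_cons.1 hD).1 _ hx).1 h
    · exact ((List.pairwise_cons.1 hD).1 _ hx).2 h
  · rintro ⟨c, hc, hn⟩
    exact ⟨⟨y, List.mem_cons_self⟩, c, ReflTransGen.mono (fun _ _ => mono) _ _ hc,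
      H c ((mem_eval_next hD').2 ⟨hc, hn⟩)⟩

/-! ### Encoding letters by a prefix code -/

/-- The code word `1ⁿ0` of the letter `n`. -/
def unary (n : ℕ) : List Bool := List.replicate n true ++ [false]

/-- The letterwise encoding of a string of letters. -/
def encode (l : List ℕ) : List Bool := l.flatMap unary

@[simp] theorem encode_nil : encode [] = [] := rfl

@[simp] theorem encode_cons (n : ℕ) (l : List ℕ) : encode (n :: l) = unary n ++ encode l := rfl

@[simp] theorem encode_append (l l' : List ℕ) : encode (l ++ l') = encode l ++ encode l' :=
  List.flatMap_append

theorem unary_append_inj {m n : ℕ} {s t : List Bool} (h : unary m ++ s = unary n ++ t) :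
    m = n ∧ s = t := by
  induction m generalizing n with
  | zero => cases n <;> simp_all [unary, List.replicate_succ]
  | succ m ih =>
    cases n with
    | zero => simp [unary, List.replicate_succ] at h
    | succ n =>
      simp only [unary, List.replicate_succ, List.cons_append, List.cons.injEq, true_and] at h
      simpa using ih h

theorem encode_prefix {x u : List ℕ} (h : encode x <+: encode u) : x <+: u := by
  induction x generalizing u with
  | nil => exact List.nil_prefix
  | cons n x ih =>
    obtain ⟨t, ht⟩ := h
    cases u with
    | nil => simp [unary] at ht
    | cons m u =>
      rw [encode_cons, encode_cons, List.append_assoc] at ht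
      obtain ⟨rfl, h⟩ := unary_append_inj ht
      exact (List.prefix_cons_inj n).2 (ih ⟨t, h⟩)

/-! ### Deque machines and their dictionaries

A deque machine with states `Q` and alphabet `Γ` is given by `δ : Q → Γ → Option Q × List Γ × List Γ`:
in state `q` it removes the first letter `a` of its string, and for `δ q a = (q', l, r)` it adds
`l` on the left and `r` on the right, and goes to the state `q'`, where `none` means halting. -/

section DequeMachine

variable {Q Γ : Type*} (δ : Q → Γ → Option Q × List Γ × List Γ)

/-- One step of a deque machine. -/
inductive DequeStep : Option Q × List Γ → Option Q × List Γ → Prop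
  | mk (q : Q) (a : Γ) (w : List Γ) :
    DequeStep (some q, a :: w) ((δ q a).1, (δ q a).2.1 ++ w ++ (δ q a).2.2)

variable (code : Option Q ⊕ Γ → ℕ)

/-- The bit string that encodes a configuration of a deque machine. -/
def encodeDeque (c : Option Q × List Γ) : List Bool :=
  encode ((Sum.inl c.1 :: c.2.map Sum.inr).map code)

/-- The letters read by a dictionary word: a letter to be copied, or a state and a letter. -/
def dequeWord : Option Q × Γ → List (Option Q ⊕ Γ)
  | (none, a) => [Sum.inr a]
  | (some q, a) => [Sum.inl (some q), Sum.inr a]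

/-- The letters written for a dictionary word. -/
def dequeTranslation : Option Q × Γ → List (Option Q ⊕ Γ)
  | (none, a) => [Sum.inr a]
  | (some q, a) =>
    (δ q a).2.2.map Sum.inr ++ Sum.inl (δ q a).1 :: (δ q a).2.1.map Sum.inr

/-- The dictionary entry that copies a letter or carries out a step of a deque machine. -/
def dequeEntry (e : Option Q × Γ) : List Bool × List Bool :=
  (encode ((dequeWord e).map code), encode ((dequeTranslation δ e).map code))

/-- The dictionary of a deque machine with states in `F`. -/
noncomputable def dequeDictionary [Fintype Γ] (F : Finset Q) : BinaryDictionary :=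
  (Finset.insertNone F ×ˢ (Finset.univ : Finset Γ)).toList.map (dequeEntry δ code)

variable {F : Finset Q} {δ code}

theorem step_dequeDictionary [Fintype Γ] {e : Option Q × Γ} (he : e.1 ∈ Finset.insertNone F)
    (r : List Bool) (u : List (Option Q ⊕ Γ)) :
    Step (dequeDictionary δ code F) ⟨r, encode ((dequeWord e ++ u).map code)⟩
      ⟨r ++ encode ((dequeWord e).map code), encode ((u ++ dequeTranslation δ e).map code)⟩ :=
  ⟨_, _, encode (u.map code), List.mem_map_of_mem (by simpa using he), by simp, rfl, by simp⟩

theorem copy_dequeDictionary [Fintype Γ] (w : List Γ) (r : List Bool) (u : List (Option Q ⊕ Γ)) :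
    ∃ r', ReflTransGen (Step (dequeDictionary δ code F))
      ⟨r, encode ((w.map Sum.inr ++ u).map code)⟩ ⟨r', encode ((u ++ w.map Sum.inr).map code)⟩ := by
  induction w generalizing r u with
  | nil => exact ⟨r, by simpa using .refl⟩
  | cons a w ih =>
    obtain ⟨r', h⟩ := ih (r ++ encode ((dequeWord (none, a)).map code)) (u ++ [Sum.inr a])
    refine ⟨r', .head (step_dequeDictionary (e := (none, a)) (by simp) r (w.map Sum.inr ++ u)) ?_⟩
    simpa [dequeTranslation] using h

/-- The step word leaves the queue as `w`, then the right letters, the new state, the left letters.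
Copying `w` and the right letters to the back brings the new state to the front, with everything in
deque order. -/
theorem DequeStep.transGen_step [Fintype Γ] {c c' : Option Q × List Γ} (h : DequeStep δ c c')
    (hc : c.1 ∈ Finset.insertNone F) (r : List Bool) :
    ∃ r', TransGen (Step (dequeDictionary δ code F))
      ⟨r, encodeDeque code c⟩ ⟨r', encodeDeque code c'⟩ := by
  cases h with
  | mk q a w =>
    obtain ⟨r₁, h₁⟩ := copy_dequeDictionary (δ := δ) (code := code) (F := F) w
      (r ++ encode ((dequeWord (some q, a)).map code)) (dequeTranslation δ (some q, a))
    obtain ⟨r₂, h₂⟩ := copy_dequeDictionary (δ := δ) (code := code) (F := F) (δ q a).2.2 r₁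
      (Sum.inl (δ q a).1 :: ((δ q a).2.1 ++ w).map Sum.inr)
    refine ⟨r₂, .head' (step_dequeDictionary (e := (some q, a)) hc r (w.map Sum.inr)) ?_⟩
    refine h₁.trans ?_
    simpa [dequeTranslation, encodeDeque] using h₂

theorem DequeStep.mem_insertNone (hδ : ∀ q ∈ F, ∀ a, (δ q a).1 ∈ Finset.insertNone F)
    {c c' : Option Q × List Γ} (h : DequeStep δ c c') (hc : c.1 ∈ Finset.insertNone F) :
    c'.1 ∈ Finset.insertNone F := by
  cases h with
  | mk q a w => exact hδ q (Finset.some_mem_insertNone.1 hc) a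

theorem transGen_dequeStep [Fintype Γ] (hδ : ∀ q ∈ F, ∀ a, (δ q a).1 ∈ Finset.insertNone F)
    {c c' : Option Q × List Γ} (h : TransGen (DequeStep δ) c c')
    (hc : c.1 ∈ Finset.insertNone F) (r : List Bool) :
    c'.1 ∈ Finset.insertNone F ∧ ∃ r', TransGen (Step (dequeDictionary δ code F))
      ⟨r, encodeDeque code c⟩ ⟨r', encodeDeque code c'⟩ := by
  induction h with
  | single h => exact ⟨h.mem_insertNone hδ hc, h.transGen_step hc r⟩
  | tail _ h ih =>
    obtain ⟨hb, r', h'⟩ := ih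
    obtain ⟨r'', h''⟩ := h.transGen_step (code := code) hb r'
    exact ⟨h.mem_insertNone hδ hb, r'', h'.trans h''⟩

/-- The letters used by the dictionary of a deque machine with states in `F`. -/
def dequeLetters (Γ : Type*) (F : Finset Q) : Set (Option Q ⊕ Γ) :=
  {l | ∀ q, l = Sum.inl (some q) → q ∈ F}

theorem encode_dequeWord_prefix (hcode : Set.InjOn code (dequeLetters Γ F))
    {e e' : Option Q × Γ} (he : e.1 ∈ Finset.insertNone F) (he' : e'.1 ∈ Finset.insertNone F)
    (h : encode ((dequeWord e).map code) <+: encode ((dequeWord e').map code)) : e = e' := by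
  have h := encode_prefix h
  have hr : ∀ a : Γ, Sum.inr a ∈ dequeLetters Γ F := fun a q h => by simp at h
  have hl : ∀ q ∈ F, Sum.inl (some q) ∈ dequeLetters Γ F := fun q hq q' h => by simp_all
  obtain ⟨_ | q, a⟩ := e <;> obtain ⟨_ | q', a'⟩ := e' <;>
    simp only [dequeWord, List.map_cons, List.map_nil, List.cons_prefix_cons, List.nil_prefix,
      and_true, List.prefix_nil, reduceCtorEq, and_false, Finset.some_mem_insertNone] at h he he'
  · simpa using hcode (hr a) (hr a') h
  · simpa using hcode (hr a) (hl q' he') h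
  · simpa using And.intro (hcode (hl q he) (hl q' he') h.1) (hcode (hr a) (hr a') h.2)

/-- No dictionary word begins with the halting letter, so first letters already differ. The free
tails let this serve both prefix-freeness and the absence of a step after halting. -/
theorem not_encode_none_prefix (hcode : Set.InjOn code (dequeLetters Γ F))
    {e : Option Q × Γ} (he : e.1 ∈ Finset.insertNone F) (u u' : List ℕ)
    (h : encode (code (Sum.inl none) :: u) <+: encode ((dequeWord e).map code ++ u') ∨
      encode ((dequeWord e).map code ++ u') <+: encode (code (Sum.inl none) :: u)) : False := by
  have hn : Sum.inl none ∈ dequeLetters Γ F := fun q h => by simp at h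
  have hr : ∀ a : Γ, Sum.inr a ∈ dequeLetters Γ F := fun a q h => by simp at h
  have hl : ∀ q ∈ F, Sum.inl (some q) ∈ dequeLetters Γ F := fun q hq q' h => by simp_all
  replace h := h.imp encode_prefix encode_prefix
  obtain ⟨_ | q, a⟩ := e <;>
    simp only [dequeWord, List.map_cons, List.cons_append, List.cons_prefix_cons,
      Finset.some_mem_insertNone] at h he
  · simpa using hcode hn (hr a) (h.elim (·.1) (·.1.symm))
  · simpa using hcode hn (hl q he) (h.elim (·.1) (·.1.symm))

/-- The dictionary of a deque machine stays prefix-free when the halting letter is added. -/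
theorem prefixFree_cons_dequeDictionary [Fintype Γ] (hcode : Set.InjOn code (dequeLetters Γ F))
    (y : List Bool) :
    PrefixFree ((encode [code (Sum.inl none)], y) :: dequeDictionary δ code F) := by
  refine List.pairwise_cons.2 ⟨?_, ?_⟩
  · intro p hp
    obtain ⟨e, he, rfl⟩ := List.mem_map.1 hp
    have he : e.1 ∈ Finset.insertNone F := by simpa using he
    have key := fun h => not_encode_none_prefix hcode he [] [] h
    simp only [List.append_nil] at key
    exact ⟨fun h => key (.inl h), fun h => key (.inr h)⟩
  · refine List.pairwise_map.2 (List.Pairwise.imp_of_mem ?_ (Finset.nodup_toList _))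
    intro e e' he he' hne
    have he : e.1 ∈ Finset.insertNone F := by simpa using he
    have he' : e'.1 ∈ Finset.insertNone F := by simpa using he'
    exact ⟨fun h => hne (encode_dequeWord_prefix hcode he he' h),
      fun h => hne (encode_dequeWord_prefix hcode he' he h).symm⟩

theorem not_step_dequeDictionary [Fintype Γ] (hcode : Set.InjOn code (dequeLetters Γ F)) (r : List Bool)
    (w : List Γ) : ¬ ∃ c', Step (dequeDictionary δ code F) ⟨r, encodeDeque code (none, w)⟩ c' := by
  rintro ⟨c', x, y, v, hx, hu, -⟩
  obtain ⟨e, he, h⟩ := List.mem_map.1 hx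
  have he : e.1 ∈ Finset.insertNone F := by simpa using he
  refine not_encode_none_prefix hcode he ((w.map Sum.inr).map code) [] (.inr ?_)
  simp only [dequeEntry, Prod.mk.injEq] at h
  rw [List.append_nil, h.1]
  exact ⟨v, hu.symm⟩

end DequeMachine

open Turing

/-! ### Stack machines as deque machines

The stacks are kept together on the deque: the letter `some (k, x)` stands for the element `x` of
the stack `k`, and a single letter `none` marks the right end. -/

section Stacks

variable {K Γ : Type*} [DecidableEq K]

/-- The stack `k` of a list of letters. -/
def stackOf (k : K) (w : List (K × Γ)) : List Γ :=
  w.filterMap fun p => if p.1 = k then some p.2 else none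

theorem stackOf_cons (k k' : K) (x : Γ) (w : List (K × Γ)) :
    stackOf k ((k', x) :: w) = if k' = k then x :: stackOf k w else stackOf k w := by
  unfold stackOf
  split_ifs with h <;> simp [h]

theorem stackOf_eraseP (k k' : K) (w : List (K × Γ)) :
    stackOf k' (w.eraseP fun p => p.1 = k) = if k' = k then (stackOf k w).tail else stackOf k' w := by
  induction w with
  | nil => simp [stackOf]
  | cons p w ih =>
    obtain ⟨k'', x⟩ := p
    by_cases h : k'' = k
    · subst h
      by_cases h' : k' = k''
      · subst h'; simp [stackOf_cons]
      · simp [stackOf_cons, h', Ne.symm h']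
    · by_cases h' : k' = k
      · subst h'; simpa [stackOf_cons, h] using ih
      · simp only [h', if_false] at ih
        simp [stackOf_cons, h, h', ih]

theorem stackOf_cons_eq_update {w : List (K × Γ)} {S : K → List Γ} (hw : (stackOf · w) = S)
    (k : K) (x : Γ) : (stackOf · ((k, x) :: w)) = Function.update S k (x :: S k) := by
  subst hw
  funext k'
  by_cases h : k' = k
  · subst h; simp [stackOf_cons]
  · simp [stackOf_cons, h, Ne.symm h]

theorem stackOf_eraseP_eq_update {w : List (K × Γ)} {S : K → List Γ} (hw : (stackOf · w) = S)
    (k : K) : (stackOf · (w.eraseP fun p => p.1 = k)) = Function.update S k (S k).tail := by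
  subst hw
  funext k'
  by_cases h : k' = k
  · subst h; simp [stackOf_eraseP]
  · simp [stackOf_eraseP, h]

end Stacks

/-! ### From stack machines to dictionaries -/

section TM2

variable {K Γ Λ σ : Type*} (M : Λ → TM2.Stmt (fun _ : K => Γ) Λ σ)

/-- The deque in normal form. -/
def dequeOf (w : List (K × Γ)) : List (Option (K × Γ)) := w.map some ++ [none]

theorem exists_dequeOf_eq_cons (w : List (K × Γ)) : ∃ a u, dequeOf w = a :: u := by
  cases w <;> simp [dequeOf]

/-- The state of the deque machine for a configuration of the stack machine. -/
def tm2State (c : TM2.Cfg (fun _ : K => Γ) Λ σ) :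
    Option (TM2.Stmt (fun _ : K => Γ) Λ σ × σ × Bool) :=
  c.l.map fun l => (M l, c.var, false)

open scoped Classical in
/-- The states of the deque machine of a stack machine with labels in `S`. -/
noncomputable def tm2States [Fintype σ] (S : Finset Λ) :
    Finset (TM2.Stmt (fun _ : K => Γ) Λ σ × σ × Bool) :=
  (S.biUnion fun l => TM2.stmts₁ (M l)) ×ˢ Finset.univ

theorem mem_tm2States [Fintype σ] {S : Finset Λ} {q : TM2.Stmt (fun _ : K => Γ) Λ σ} {v : σ}
    {b : Bool} : (q, v, b) ∈ tm2States M S ↔ ∃ l ∈ S, q ∈ TM2.stmts₁ (M l) := by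
  simp [tm2States]

variable [DecidableEq K]

/-- The deque machine of a stack machine: a state consists of the statement to be executed, the
local variable, and a bit telling that the deque is being rotated back to its normal form. -/
def tm2Deque : TM2.Stmt (fun _ : K => Γ) Λ σ × σ × Bool → Option (K × Γ) →
    Option (TM2.Stmt (fun _ : K => Γ) Λ σ × σ × Bool) × List (Option (K × Γ)) ×
      List (Option (K × Γ))
  | (q, v, true), none => (some (q, v, false), [], [none])
  | (q, v, true), some p => (some (q, v, true), [], [some p])
  | (.push k f q, v, false), a => (some (q, v, false), [some (k, f v), a], [])
  | (.peek _ f q, v, false), none => (some (q, f v none, false), [], [none])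
  | (.peek k f q, v, false), some p =>
    if p.1 = k then (some (q, f v (some p.2), true), [], [some p])
    else (some (.peek k f q, v, false), [], [some p])
  | (.pop _ f q, v, false), none => (some (q, f v none, false), [], [none])
  | (.pop k f q, v, false), some p =>
    if p.1 = k then (some (q, f v (some p.2), true), [], [])
    else (some (.pop k f q, v, false), [], [some p])
  | (.load g q, v, false), a => (some (q, g v, false), [a], [])
  | (.branch g q₁ q₂, v, false), a => (some (bif g v then q₁ else q₂, v, false), [a], [])
  | (.goto l, v, false), a => (some (M (l v), v, false), [a], [])
  | (.halt, _, false), a => (none, [a], [])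

theorem rotate_tm2Deque (q : TM2.Stmt (fun _ : K => Γ) Λ σ) (v : σ) (u w : List (K × Γ)) :
    ReflTransGen (DequeStep (tm2Deque M)) (some (q, v, true), w.map some ++ none :: u.map some)
      (some (q, v, false), dequeOf (u ++ w)) := by
  induction w generalizing u with
  | nil =>
    have := DequeStep.mk (δ := tm2Deque M) (q, v, true) none (u.map some)
    exact .single (by simpa [tm2Deque, dequeOf] using this)
  | cons p w ih =>
    refine .head (DequeStep.mk _ _ _) ?_
    simpa [tm2Deque] using ih (u ++ [p])

/-- For the induction, `u` holds the letters already scanned and moved behind the marker. If the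
marker comes up first, stack `k` is empty and the deque is again in normal form; otherwise
`rotate_tm2Deque` restores it. -/
theorem peek_tm2Deque (k : K) (f : σ → Option Γ → σ) (q : TM2.Stmt (fun _ : K => Γ) Λ σ) (v : σ)
    (u w : List (K × Γ)) :
    TransGen (DequeStep (tm2Deque M))
      (some (.peek k f q, v, false), w.map some ++ none :: u.map some)
      (some (q, f v (stackOf k w).head?, false), dequeOf (u ++ w)) := by
  induction w generalizing u with
  | nil =>
    have := DequeStep.mk (δ := tm2Deque M) (.peek k f q, v, false) none (u.map some)
    exact .single (by simpa [tm2Deque, dequeOf, stackOf] using this)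
  | cons p w ih =>
    obtain ⟨k', x⟩ := p
    by_cases h : k' = k
    · refine .head' (DequeStep.mk _ _ _) ?_
      simpa [tm2Deque, h, stackOf_cons] using
        rotate_tm2Deque M q (f v (some x)) (u ++ [(k', x)]) w
    · refine .head (DequeStep.mk _ _ _) ?_
      simpa [tm2Deque, h, stackOf_cons] using ih (u ++ [(k', x)])

theorem pop_tm2Deque (k : K) (f : σ → Option Γ → σ) (q : TM2.Stmt (fun _ : K => Γ) Λ σ) (v : σ)
    (u w : List (K × Γ)) :
    TransGen (DequeStep (tm2Deque M))
      (some (.pop k f q, v, false), w.map some ++ none :: u.map some)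
      (some (q, f v (stackOf k w).head?, false),
        dequeOf (u ++ w.eraseP fun p => p.1 = k)) := by
  induction w generalizing u with
  | nil =>
    have := DequeStep.mk (δ := tm2Deque M) (.pop k f q, v, false) none (u.map some)
    exact .single (by simpa [tm2Deque, dequeOf, stackOf] using this)
  | cons p w ih =>
    obtain ⟨k', x⟩ := p
    by_cases h : k' = k
    · refine .head' (DequeStep.mk _ _ _) ?_
      simpa [tm2Deque, h, stackOf_cons] using rotate_tm2Deque M q (f v (some x)) u w
    · refine .head (DequeStep.mk _ _ _) ?_
      simpa [tm2Deque, h, stackOf_cons] using ih (u ++ [(k', x)])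

/-- Only the stacks extracted from the deque matter, not their interleaving, so `w'` is existential.
The marker guarantees a front letter, which even statements not touching the stacks must consume and
put back. -/
theorem transGen_tm2Deque (q : TM2.Stmt (fun _ : K => Γ) Λ σ) (v : σ) (S : K → List Γ)
    (w : List (K × Γ)) (hw : (stackOf · w) = S) :
    ∃ w', (stackOf · w') = (TM2.stepAux q v S).stk ∧
      TransGen (DequeStep (tm2Deque M)) (some (q, v, false), dequeOf w)
        (tm2State M (TM2.stepAux q v S), dequeOf w') := by
  obtain ⟨a, u, hu⟩ := exists_dequeOf_eq_cons w
  have step (q : TM2.Stmt (fun _ : K => Γ) Λ σ) :=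
    DequeStep.mk (δ := tm2Deque M) (q, v, false) a u
  induction q generalizing v S w a u with
  | push k f q ih =>
    obtain ⟨a', u', hu'⟩ := exists_dequeOf_eq_cons ((k, f v) :: w)
    obtain ⟨w', hw', h⟩ := ih v _ ((k, f v) :: w) (stackOf_cons_eq_update hw k (f v)) a' u' hu'
      (fun q => .mk _ _ _)
    refine ⟨w', hw', .head ?_ h⟩
    have := step (.push k f q)
    rw [hu]
    simpa [tm2Deque, dequeOf, ← hu] using this
  | peek k f q ih =>
    obtain ⟨w', hw', h⟩ := ih (f v (S k).head?) S w hw a u hu (fun q => .mk _ _ _)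
    refine ⟨w', hw', .trans ?_ h⟩
    subst hw
    simpa [dequeOf] using peek_tm2Deque M k f q v [] w
  | pop k f q ih =>
    obtain ⟨a', u', hu'⟩ := exists_dequeOf_eq_cons (w.eraseP fun p => p.1 = k)
    obtain ⟨w', hw', h⟩ := ih (f v (S k).head?) _ _ (stackOf_eraseP_eq_update hw k) a' u' hu'
      (fun q => .mk _ _ _)
    refine ⟨w', hw', .trans ?_ h⟩
    subst hw
    simpa [dequeOf] using pop_tm2Deque M k f q v [] w
  | load g q ih =>
    obtain ⟨w', hw', h⟩ := ih (g v) S w hw a u hu (fun q => .mk _ _ _)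
    refine ⟨w', hw', .head ?_ h⟩
    rw [hu]
    simpa [tm2Deque] using step (.load g q)
  | branch g q₁ q₂ ih₁ ih₂ =>
    have := step (.branch g q₁ q₂)
    rw [TM2.stepAux]
    cases hg : g v with
    | true =>
      obtain ⟨w', hw', h⟩ := ih₁ v S w hw a u hu step
      refine ⟨w', hw', .head ?_ h⟩
      rw [hu]
      simpa [tm2Deque, hg] using this
    | false =>
      obtain ⟨w', hw', h⟩ := ih₂ v S w hw a u hu step
      refine ⟨w', hw', .head ?_ h⟩
      rw [hu]
      simpa [tm2Deque, hg] using this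
  | goto l =>
    refine ⟨w, hw, .single ?_⟩
    rw [hu]
    simpa [tm2Deque, tm2State] using step (.goto l)
  | halt =>
    refine ⟨w, hw, .single ?_⟩
    rw [hu]
    simpa [tm2Deque, tm2State] using step .halt

theorem tm2Deque_mem_tm2States [Fintype σ] {S : Finset Λ} (hS : ∀ l ∈ S, TM2.SupportsStmt S (M l)) :
    ∀ q ∈ tm2States M S, ∀ a, (tm2Deque M q a).1 ∈ Finset.insertNone (tm2States M S) := by
  rintro ⟨q, v, b⟩ hq a
  obtain ⟨l, hl, hq⟩ := (mem_tm2States M).1 hq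
  have key : ∀ q' ∈ TM2.stmts₁ q, ∀ v b,
      some (q', v, b) ∈ Finset.insertNone (tm2States M S) := fun q' hq' v b =>
    Finset.some_mem_insertNone.2 ((mem_tm2States M).2 ⟨l, hl, TM2.stmts₁_trans hq hq'⟩)
  have self := key q TM2.stmts₁_self
  have sub := TM2.stmts₁_supportsStmt_mono hq (hS l hl)
  cases b with
  | true => cases a <;> exact self _ _
  | false =>
    cases q with
    | push k f q => cases a <;> exact key _ (by simp [TM2.stmts₁, TM2.stmts₁_self]) _ _
    | load g q => cases a <;> exact key _ (by simp [TM2.stmts₁, TM2.stmts₁_self]) _ _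
    | peek k f q | pop k f q =>
      cases a with
      | none => exact key _ (by simp [TM2.stmts₁, TM2.stmts₁_self]) _ _
      | some p =>
        simp only [tm2Deque]
        split_ifs
        · exact key _ (by simp [TM2.stmts₁, TM2.stmts₁_self]) _ _
        · exact self _ _
    | branch g q₁ q₂ =>
      refine key _ ?_ _ _
      cases g v <;> simp [TM2.stmts₁, TM2.stmts₁_self]
    | goto l' =>
      exact Finset.some_mem_insertNone.2 ((mem_tm2States M).2 ⟨_, sub v, TM2.stmts₁_self⟩)
    | halt => simp [tm2Deque]

variable [Fintype K] [Fintype Γ] [Fintype σ]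

/-- The dictionary of a stack machine with labels in `S`. -/
noncomputable def tm2Dictionary
    (code : Option (TM2.Stmt (fun _ : K => Γ) Λ σ × σ × Bool) ⊕ Option (K × Γ) → ℕ)
    (S : Finset Λ) : BinaryDictionary :=
  dequeDictionary (tm2Deque M) code (tm2States M S)

/-- The stages of the dictionary process that represent a configuration of a stack machine. -/
def TM2Represents
    (code : Option (TM2.Stmt (fun _ : K => Γ) Λ σ × σ × Bool) ⊕ Option (K × Γ) → ℕ)
    (S : Finset Λ) (c : TM2.Cfg (fun _ : K => Γ) Λ σ) (d : Config) : Prop :=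
  c.l ∈ Finset.insertNone S ∧ ∃ w, (stackOf · w) = c.stk ∧
    d.unread = encodeDeque code (tm2State M c, dequeOf w)

/-- Each machine step becomes at least one dictionary step, and a halted machine a stage without
one; hence halting transfers in both directions. -/
theorem respects_tm2Dictionary
    {code : Option (TM2.Stmt (fun _ : K => Γ) Λ σ × σ × Bool) ⊕ Option (K × Γ) → ℕ}
    {S : Finset Λ} (hS : ∀ l ∈ S, TM2.SupportsStmt S (M l))
    (hcode : Set.InjOn code (dequeLetters (Option (K × Γ)) (tm2States M S))) :
    Respects (TM2.step M) (next (tm2Dictionary M code S)) (TM2Represents M code S) := by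
  have hD : (tm2Dictionary M code S).PrefixFree :=
    (List.pairwise_cons.1 (prefixFree_cons_dequeDictionary hcode [])).2
  rintro ⟨l, v, T⟩ ⟨r, u⟩ ⟨hl, w, hw, hu⟩
  cases l with
  | none =>
    simp only at hu
    subst hu
    exact next_eq_none.2 (not_step_dequeDictionary hcode r (dequeOf w))
  | some l =>
    have hl := Finset.some_mem_insertNone.1 hl
    obtain ⟨w', hw', h⟩ := transGen_tm2Deque M (M l) v T w hw
    obtain ⟨hF, r', h'⟩ := transGen_dequeStep (code := code) (tm2Deque_mem_tm2States M hS) h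
      (Finset.some_mem_insertNone.2 ((mem_tm2States M).2 ⟨l, hl, TM2.stmts₁_self⟩)) r
    refine ⟨⟨r', _⟩, ⟨?_, w', hw', rfl⟩, ?_⟩
    · let _ : Inhabited Λ := ⟨l⟩
      exact TM2.step_supports M ⟨hl, hS⟩ (c := ⟨some l, v, T⟩) rfl
        (Finset.some_mem_insertNone.2 hl)
    · simp only at hu
      subst hu
      rw [StateTransition.Reaches₁, next_rel hD]
      exact h'

end TM2

/-! ### An undecidable family of starting strings -/

section Undecidability

open PartrecToTM2

/-- Inputs are written in binary, lowest bit first. Restricting to powers of two makes the starting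
string a repeated letter between constant ends, so its computability is immediate. -/
theorem trNat_two_pow (n : ℕ) :
    trNat (2 ^ n) = List.replicate n Γ'.bit0 ++ [Γ'.bit1] := by
  have key : ∃ p : PosNum, ((2 ^ n : ℕ) : Num) = .pos p ∧
      trPosNum p = List.replicate n Γ'.bit0 ++ [Γ'.bit1] := by
    induction n with
    | zero => exact ⟨1, rfl, rfl⟩
    | succ n ih =>
      obtain ⟨p, hp, h⟩ := ih
      refine ⟨p.bit0, ?_, by simp [trPosNum, h, List.replicate_succ]⟩
      rw [pow_succ, mul_two, Nat.cast_add, hp]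
      exact congrArg Num.pos p.bit0_of_bit0
  obtain ⟨p, hp, h⟩ := key
  rw [trNat, hp, trNum, h]

theorem primrec_two_pow : Primrec fun n : ℕ => 2 ^ n :=
  (Primrec.nat_rec₁ 1 (Primrec.nat_mul.comp₂ Primrec₂.right (Primrec₂.const 2))).of_eq fun n => by
    induction n with
    | zero => rfl
    | succ n ih => simp [pow_succ, ← ih]

/-- There is a program on lists of natural numbers whose halting on powers of two is undecidable. -/
theorem exists_code_halting_undecidable :
    ∃ c : ToPartrec.Code, ¬ ComputablePred fun n : ℕ => (c.eval [2 ^ n]).Dom := by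
  classical
  -- The program recovers `n` from `2 ^ n`; the value 0 at other inputs plays no role.
  let log (m : ℕ) : ℕ := m.findGreatest fun k => 2 ^ k = m
  have hlog : Primrec log := Primrec.nat_findGreatest .id
    (Primrec.eq.comp₂ (primrec_two_pow.comp₂ Primrec₂.right) Primrec₂.left)
  have log_pow (n : ℕ) : log (2 ^ n) = n := by
    have h := Nat.findGreatest_spec (P := fun k => 2 ^ k = 2 ^ n) Nat.lt_two_pow_self.le rfl
    exact Nat.pow_right_injective le_rfl h
  have hf : Partrec fun m : ℕ => Nat.Partrec.Code.eval (Denumerable.ofNat Nat.Partrec.Code (log m)) 0 :=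
    Nat.Partrec.Code.eval_part.comp ((Computable.ofNat _).comp hlog.to_comp) (Computable.const 0)
  obtain ⟨c, hc⟩ := ToPartrec.Code.exists_code (Nat.Partrec'.part_iff₁.2 hf)
  refine ⟨c, fun h => ComputablePred.halting_problem 0
    (ComputablePred.computable_of_manyOneReducible
      ⟨Encodable.encode, Computable.encode, fun c' => ?_⟩ h)⟩
  have key := congrArg Part.Dom (hc ((2 ^ Encodable.encode c') ::ᵥ .nil))
  refine Iff.trans ?_ (iff_of_eq key).symm
  change _ ↔ (Nat.Partrec.Code.eval
    (Denumerable.ofNat Nat.Partrec.Code (log (2 ^ Encodable.encode c'))) 0).Dom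
  rw [log_pow, Denumerable.ofNat_encode]

theorem dequeLetters_finite {Q Γ : Type*} [Finite Γ] (F : Finset Q) :
    (dequeLetters Γ F).Finite := by
  refine (((Finset.insertNone F).finite_toSet.image Sum.inl).union
    (Set.finite_range (Sum.inr : Γ → Option Q ⊕ Γ))).subset ?_
  rintro ((_ | q) | a) h
  · simp
  · simpa using h _ rfl
  · simp

theorem computable_encode_replicate (p t : List ℕ) (z : ℕ) :
    Computable fun n => encode (p ++ List.replicate n z ++ t) := by
  have hrec : Primrec fun n => encode (List.replicate n z) :=
    (Primrec.nat_rec₁ [] (Primrec.list_append.comp₂ (Primrec₂.const (unary z))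
      Primrec₂.right)).of_eq fun n => by
        induction n with
        | zero => rfl
        | succ n ih => simp [List.replicate_succ, ← ih]
  refine (Primrec.list_append.comp (Primrec.list_append.comp (Primrec.const (encode p)) hrec)
    (Primrec.const (encode t))).to_comp.of_eq fun n => ?_
  simp

instance : Fintype K' := ⟨{.main, .rev, .aux, .stack}, fun k => by cases k <;> simp⟩

/-- There are a prefix-free dictionary and a computable family of starting strings for which
termination is undecidable, and equivalent to reading a fixed word of a larger dictionary. -/
theorem exists_dictionary_undecidable :
    ∃ (D : BinaryDictionary) (w y : List Bool) (A : ℕ → List Bool), Computable A ∧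
      PrefixFree ((w, y) :: D) ∧ (∀ n, EverReads ((w, y) :: D) (A n) w ↔ D.Terminates (A n)) ∧
      ¬ ComputablePred fun n => D.Terminates (A n) := by
  obtain ⟨c, hc⟩ := exists_code_halting_undecidable
  let S := codeSupp c Cont'.halt
  have hS : ∀ l ∈ S, TM2.SupportsStmt S (tr l) := (tr_supports c Cont'.halt).2
  have hl : trNormal c Cont'.halt ∈ S := (tr_supports c Cont'.halt).1
  -- There are infinitely many statements, so injectivity is asked only on the finitely many letters
  -- in use.
  obtain ⟨code, hcode⟩ := Set.countable_iff_exists_injOn.1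
    (dequeLetters_finite (Γ := Option (K' × Γ')) (tm2States tr S)).countable
  let D := tm2Dictionary tr code S
  have hpf : PrefixFree ((encode [code (Sum.inl none)], []) :: D) :=
    prefixFree_cons_dequeDictionary hcode []
  have hD : D.PrefixFree := (List.pairwise_cons.1 hpf).2
  let cfg (n : ℕ) := init c [2 ^ n]
  let stk (n : ℕ) : List (K' × Γ') := (trList [2 ^ n]).map (Prod.mk K'.main)
  let A (n : ℕ) : List Bool := encodeDeque code (tm2State tr (cfg n), dequeOf (stk n))
  have hR := respects_tm2Dictionary tr hS hcode
  have hA (n : ℕ) : TM2Represents tr code S (cfg n) (start (A n)) := by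
    refine ⟨Finset.some_mem_insertNone.2 hl, stk n, ?_, rfl⟩
    funext k
    cases k <;> simp [cfg, init, stk, stackOf]
  refine ⟨D, encode [code (Sum.inl none)], [], A, ?_, hpf, fun n => ?_, fun h => hc ?_⟩
  -- The initial state does not depend on `n`, so `cfg 0` supplies its letter.
  · refine (computable_encode_replicate [code (.inl (tm2State tr (cfg 0)))]
      ([some (K'.main, Γ'.bit1), some (K'.main, Γ'.cons), none].map (code ∘ Sum.inr))
      (code (.inr (some (K'.main, Γ'.bit0))))).of_eq fun n => ?_
    simp [A, encodeDeque, cfg, init, tm2State, stk, dequeOf, trList, trNat_two_pow]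
  · refine everReads_cons_iff hpf fun d hd => ?_
    -- A final stage represents a final machine configuration, whose label is `none`; so the halting
    -- letter is in front.
    obtain ⟨b, ⟨-, w, -, hu⟩, hb⟩ := tr_eval_rev hR (hA n) hd
    have hb := (mem_eval.1 hb).2
    obtain ⟨_ | l, v, T⟩ := b
    · rw [hu]
      exact ⟨encode (((dequeOf w).map Sum.inr).map code), by simp [encodeDeque, tm2State]⟩
    · exact absurd hb (Option.some_ne_none _)
  · refine h.of_eq fun n => ?_
    rw [terminates_iff hD, tr_eval_dom hR (hA n), PartrecToTM2.tr_eval]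
    rfl

end Undecidability

end BinaryDictionary

/-- No algorithm decides, for all prefix-free binary dictionaries `D` and starting strings `A`,
whether the process terminates; and none decides, for all `D`, `A` and binary strings `w`, whether
the word `w` is ever read. (Nothing is required of the algorithm on dictionaries that are not
prefix-free.) -/
theorem mainTheorem7 :
    (¬ ∃ P : BinaryDictionary × List Bool → Prop, ComputablePred P ∧
      ∀ (D : BinaryDictionary) (A : List Bool), D.PrefixFree →
        (P (D, A) ↔ D.Terminates A)) ∧
    (¬ ∃ P : BinaryDictionary × List Bool × List Bool → Prop, ComputablePred P ∧
      ∀ (D : BinaryDictionary) (A w : List Bool), D.PrefixFree →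
        (P (D, A, w) ↔ D.EverReads A w)) := by
  obtain ⟨D, w, y, A, hA, hpf, hiff, hundec⟩ := BinaryDictionary.exists_dictionary_undecidable
  constructor
  · rintro ⟨P, hP, h⟩
    exact hundec (ComputablePred.computable_of_manyOneReducible
      ⟨fun n => (D, A n), (Computable.const D).pair hA,
        fun n => (h D (A n) (List.pairwise_cons.1 hpf).2).symm⟩ hP)
  · rintro ⟨P, hP, h⟩
    exact hundec (ComputablePred.computable_of_manyOneReducible
      ⟨fun n => ((w, y) :: D, A n, w),
        (Computable.const ((w, y) :: D)).pair (hA.pair (Computable.const w)),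
        fun n => ((h _ (A n) w hpf).trans (hiff n)).symm⟩ hP)
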